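/- Let $G=(V,E)$ be a finite connected graph whose nodes have distinct ids from a linear order. A connected dominating set (CDS) of $G$ is a set $D\subseteq V$ such that every node is in $D$ or adjacent to a node of $D$ and the induced subgraph $G[D]$ is connected (and nonempty). Let $D_{opt}$ be a CDS of minimum size, $\Delta$ the maximum degree of $G$, $H(i)=\sum_{j=1}^{i}1/j$, and $\mathrm{diam}$ the hop diameter. Algorithm. (1) Find a CDS $D_0$ of $G$ (an approximate minimum CDS). (2) Let $r$ be the node of $D_0$ with minimum id and run a depth-first traversal of $G[D_0]$ from $r$ (visiting neighbours in any order and walking back to the parent when no unvisited neighbour is left); this is a closed walk through all nodes of $D_0$. Put a node that the traversal meets $p$ steps after its start into cluster $\lfloor p/\mathrm{diam}(G)\rfloor$; a node that is met more than once takes the cluster of an arbitrary one of these occurrences. (If $\mathrm{diam}(G)=0$ there is a single node and a single cluster.) (3) The leader of each nonempty cluster is its node with minimum id. Join every leader to $r$ by a shortest path of $G$, arbitrarily chosen, and return the set $D$ consisting of $D_0$ and all nodes of these paths. Theorem. For every CDS $D_0$ found in step (1), the algorithm can be run to completion, and every set $D$ that it can return, whatever choices are made, satisfies: (a) $D$ is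 a connected dominating set of $G$, and $\mathrm{diam}(G[D])\le 4\,\mathrm{diam}(G)$. (b) If $|D_0|\le\alpha|D_{opt}|$ for a real $\alpha$, then $|D|\le 3\alpha|D_{opt}|$. In particular: (c) if step (1) uses a $(2+H(\Delta))$-approximation of the minimum CDS, that is $|D_0|\le(2+H(\Delta))|D_{opt}|$, then $|D|\le 3(2+H(\Delta))|D_{opt}|$; (d) if $G$ is a unit disk graph (its nodes can be placed in the Euclidean plane so that two distinct nodes are adjacent iff their distance is at most $1$) and step (1) uses a $7.8$-approximation, that is $|D_0|\le 7.8|D_{opt}|$, then $|D|\le 23.4|D_{opt}|$; and if $|D_0|\le 5.2|D_{opt}|$, then $|D|\le 15.6|D_{opt}|$. -/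

import Mathlib

namespace ShortCDS

/-- `D` is a connected dominating set of `G`: every node is in `D` or adjacent to a node of `D`,
and the subgraph induced by `D` is connected (in particular `D` is nonempty). -/
def IsCDS {V : Type*} (G : SimpleGraph V) (D : Finset V) : Prop :=
  (∀ v, v ∈ D ∨ ∃ u ∈ D, G.Adj u v) ∧ (G.induce (D : Set V)).Connected

/-- `D` is a connected dominating set of minimum size (an MCDS). -/
def IsMinCDS {V : Type*} (G : SimpleGraph V) (D : Finset V) : Prop :=
  IsCDS G D ∧ ∀ E : Finset V, IsCDS G E → D.card ≤ E.card

/-- `G` is a unit disk graph: its nodes are placed in the plane, and two distinct nodes are adjacent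
iff their Euclidean distance is at most one. -/
def IsUnitDiskGraph {V : Type*} (G : SimpleGraph V) : Prop :=
  ∃ pos : V → EuclideanSpace ℝ (Fin 2), ∀ u v, G.Adj u v ↔ u ≠ v ∧ dist (pos u) (pos v) ≤ 1

/-- The states reachable by a depth-first search on the subgraph of `G` induced by `D`.
`DFSState G D s t` says: `s` is the current stack (its head is the current node, its second entry
the DFS parent of the current node, and so on), and `t` is the sequence of nodes at which the
search has been so far, in order of time and with repetitions.
The search moves to a not yet visited neighbour of the current node if there is one, and otherwise
moves back to the parent; any order of the neighbours is allowed. -/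
inductive DFSState {V : Type*} (G : SimpleGraph V) (D : Finset V) : List V → List V → Prop
  | start (r : V) (hr : r ∈ D) : DFSState G D [r] [r]
  | forward (u v : V) (s t : List V) (h : DFSState G D (u :: s) t)
      (hv : v ∈ D) (huv : G.Adj u v) (hnew : v ∉ t) : DFSState G D (v :: u :: s) (t ++ [v])
  | back (u p : V) (s t : List V) (h : DFSState G D (u :: p :: s) t)
      (hdone : ∀ v ∈ D, G.Adj u v → v ∈ t) : DFSState G D (p :: s) (t ++ [p])

/-- `t` is the node sequence of a complete DFS traversal of `D` that starts (and ends) at `r`. -/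
def IsDFSTraversal {V : Type*} (G : SimpleGraph V) (D : Finset V) (r : V) (t : List V) : Prop :=
  DFSState G D [r] t ∧ ∀ v ∈ D, G.Adj r v → v ∈ t

/-- `cl` partitions `D` into clusters along the traversal `t`: a node that the traversal meets
`p` steps after its start may be put into cluster `⌊p / diam G⌋`; a node that is met more than once
takes the cluster of any one of these occurrences. -/
def IsClustering {V : Type*} (G : SimpleGraph V) (D : Finset V) (t : List V) (cl : V → ℕ) : Prop :=
  ∀ v ∈ D, ∃ p : ℕ, t[p]? = some v ∧ cl v = p / G.diam

/-- The cluster leaders: the nodes of `D` with minimum id in their cluster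
(the ids of the nodes are their ranks in the linear order). -/
def leaders {V : Type*} [LinearOrder V] (D : Finset V) (cl : V → ℕ) : Finset V :=
  D.filter fun c => ∀ v ∈ D, cl v = cl c → c ≤ v

/-- `D` can be returned by the algorithm when the connected dominating set found in its first line
is `D₀`: let `r` be the node of `D₀` with minimum id, run a DFS traversal `t` on `D₀` from `r`, split
`D₀` into clusters along it, join every cluster leader `c` to `r` by a shortest path `P c` of `G`,
and add the nodes of these paths to `D₀`. -/
def IsOutput {V : Type*} [LinearOrder V] (G : SimpleGraph V) (D₀ D : Finset V) : Prop :=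
  ∃ (r : V) (t : List V) (cl : V → ℕ) (P : (c : V) → G.Walk c r),
    (r ∈ D₀ ∧ ∀ v ∈ D₀, r ≤ v) ∧
    IsDFSTraversal G D₀ r t ∧
    IsClustering G D₀ t cl ∧
    (∀ c ∈ leaders D₀ cl, (P c).length = G.dist c r) ∧
    D = D₀ ∪ (leaders D₀ cl).biUnion fun c => (P c).support.toFinset

end ShortCDS

/-!
Every node `v` of `D` is within distance `2 * diam G` of the root `r` inside `G[D]`. If `v` lies on
one of the added shortest paths, follow that path to `r`. If `v ∈ D₀`, walk along the depth-first
traversal from an occurrence of `v` to an occurrence of the leader of its cluster; the two positions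
lie in the same block of `diam G` consecutive positions, so this takes fewer than `diam G` steps
inside `D₀`, and the leader's path to `r` takes at most `diam G` more. Hence `G[D]` is connected and
its diameter is at most `4 * diam G` (`isCDS_of_isOutput`, `diam_induce_le_of_isOutput`).

For the size, the depth-first search preserves
`(length of the traversal) + (height of the stack) = 2 * (number of visited nodes)`
(`DFSState.length_add_length`), so a complete traversal occupies at most `2 * |D₀| - 1` positions.
Blocks of length `diam G` cut it into at most `(2 * |D₀| - 2) / diam G + 1` clusters, each of which
has one leader. The root `r` is itself a leader and its path is trivial, and every other path adds
at most `diam G` nodes different from `r`. So at most `2 * |D₀| - 2` nodes are added to `D₀`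
(`card_le_of_isOutput`), and the approximation ratios follow by multiplying by three.

A run of the algorithm exists because `2 * (number of unvisited nodes) + (height of the stack)`
decreases at every step of the search (`DFSState.exists_isDFSTraversal`), and because every visited
node outside the stack has only visited neighbours, so that a complete search visits all of the
connected graph `G[D₀]` (`IsDFSTraversal.mem_of_connected`).
-/

namespace ShortCDS

open SimpleGraph

variable {V : Type*} {G : SimpleGraph V} {D : Finset V}

/-! ### Invariants of the depth-first search -/

lemma DFSState.stack_subset {s t : List V} (h : DFSState G D s t) : ∀ v ∈ s, v ∈ t := by
  induction h with
  | start r hr => simp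
  | forward u v s t h hv huv hnew ih => grind
  | back u p s t h hdone ih => grind

lemma DFSState.subset {s t : List V} (h : DFSState G D s t) : ∀ v ∈ t, v ∈ D := by
  induction h with
  | start r hr => simpa using hr
  | forward u v s t h hv huv hnew ih => grind
  | back u p s t h hdone ih =>
    have := h.stack_subset p
    grind

/-- Consecutive entries of the stack are adjacent: each is the DFS parent of the one above it. -/
lemma DFSState.isChain_stack {s t : List V} (h : DFSState G D s t) : s.IsChain G.Adj := by
  induction h with
  | start r hr => simp
  | forward u v s t h hv huv hnew ih => exact List.isChain_cons_cons.2 ⟨huv.symm, ih⟩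
  | back u p s t h hdone ih => exact (List.isChain_cons_cons.1 ih).2

/-- The last node of the search so far is the top of the stack, the current node. -/
lemma DFSState.getLast?_eq_head? {s t : List V} (h : DFSState G D s t) :
    t.getLast? = s.head? := by
  cases h <;> simp

/-- The node sequence of the search is a walk in `G`. -/
lemma DFSState.isChain {s t : List V} (h : DFSState G D s t) : t.IsChain G.Adj := by
  induction h with
  | start r hr => simp
  | forward u v s t h hv huv hnew ih =>
    have := h.getLast?_eq_head?
    exact List.isChain_append.2 ⟨ih, by simp, by simp_all⟩
  | back u p s t h hdone ih =>
    have h1 := h.getLast?_eq_head?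
    have h2 := (List.isChain_cons_cons.1 h.isChain_stack).1
    exact List.isChain_append.2 ⟨ih, by simp, by simp_all⟩

/-- A forward step visits a new node and pushes it, a backward step pops a node: either way the sum
of the elapsed time and the height of the stack stays twice the number of visited nodes. -/
lemma DFSState.length_add_length [DecidableEq V] {s t : List V} (h : DFSState G D s t) :
    t.length + s.length = 2 * t.toFinset.card := by
  induction h with
  | start r hr => simp
  | forward u v s t h hv huv hnew ih =>
    have : (t ++ [v]).toFinset = insert v t.toFinset := by ext; simp
    rw [this, Finset.card_insert_of_notMem (by simpa using hnew)]
    simp at ih ⊢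
    omega
  | back u p s t h hdone ih =>
    have hp : p ∈ t := h.stack_subset p (by simp)
    have : (t ++ [p]).toFinset = t.toFinset := by ext; simp; grind
    rw [this]
    simp at ih ⊢
    omega

/-- A node that has been popped from the stack has no unvisited neighbour in `D`. -/
lemma DFSState.mem_of_adj_of_notMem_stack {s t : List V} (h : DFSState G D s t) :
    ∀ u ∈ t, u ∉ s → ∀ v ∈ D, G.Adj u v → v ∈ t := by
  induction h with
  | start r hr => simp
  | forward u v s t h hv huv hnew ih => grind
  | back u p s t h hdone ih => grind

/-! ### Complete traversals -/

lemma IsDFSTraversal.length_le {r : V} {t : List V} (h : IsDFSTraversal G D r t) :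
    t.length + 1 ≤ 2 * D.card := by
  classical
  have h1 := h.1.length_add_length
  have h2 : t.toFinset.card ≤ D.card :=
    Finset.card_le_card fun v hv => h.1.subset v (List.mem_toFinset.1 hv)
  simp at h1
  omega

/-- A complete traversal of a connected set visits all of it: the set of visited nodes is closed under
adjacency in `D`. -/
lemma IsDFSTraversal.mem_of_connected {r : V} {t : List V} (h : IsDFSTraversal G D r t)
    (hD : (G.induce (D : Set V)).Connected) : ∀ v ∈ D, v ∈ t := by
  have closed : ∀ u ∈ t, ∀ v ∈ D, G.Adj u v → v ∈ t := by
    intro u hu v hv huv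
    by_cases hur : u = r
    · exact h.2 v hv (hur ▸ huv)
    · exact h.1.mem_of_adj_of_notMem_stack u hu (by simpa using hur) v hv huv
  have hr : r ∈ t := h.1.stack_subset r (by simp)
  intro v hv
  obtain ⟨w⟩ := hD.preconnected ⟨r, h.1.subset r hr⟩ ⟨v, hv⟩
  have key : ∀ {a b : (D : Set V)} (w : (G.induce (D : Set V)).Walk a b), a.1 ∈ t → b.1 ∈ t := by
    intro a b w
    induction w with
    | nil => exact id
    | cons hab _ ih => exact fun ha => ih (closed _ ha _ (Subtype.prop _) hab)
  exact key w hr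

/-- Every state of the search can be continued to a complete traversal. -/
lemma DFSState.exists_isDFSTraversal {r : V} {s t : List V} (h : DFSState G D s t)
    (hr : s.getLast? = some r) : ∃ t', IsDFSTraversal G D r t' := by
  classical
  induction hn : 2 * (D \ t.toFinset).card + s.length using Nat.strong_induction_on
    generalizing s t with
  | _ n ih =>
  subst hn
  match s, h, hr with
  | u :: s, h, hr =>
    by_cases hnew : ∃ v ∈ D, G.Adj u v ∧ v ∉ t
    · obtain ⟨v, hv, huv, hvt⟩ := hnew
      refine ih _ ?_ (h.forward u v s t hv huv hvt) (by simpa using hr) rfl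
      have : D \ (t ++ [v]).toFinset = (D \ t.toFinset).erase v := by ext; simp; grind
      have hmem : v ∈ D \ t.toFinset := by simp [hv, hvt]
      have hpos := Finset.card_pos.2 ⟨v, hmem⟩
      rw [this, Finset.card_erase_of_mem hmem]
      simp
      omega
    · push Not at hnew
      match s, h, hr with
      | [], h, hr =>
        obtain rfl : u = r := by simpa using hr
        exact ⟨t, h, hnew⟩
      | p :: s, h, hr =>
        refine ih _ ?_ (h.back u p s t hnew) (by simpa using hr) rfl
        have hp : p ∈ t := h.stack_subset p (by simp)
        have : D \ (t ++ [p]).toFinset = D \ t.toFinset := by ext; simp; grind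
        rw [this]
        simp

/-! ### Walking along the traversal -/

lemma exists_walk_of_isChain {t : List V} (h : t.IsChain G.Adj) {p q : ℕ} (hpq : p ≤ q)
    {u v : V} (hu : t[p]? = some u) (hv : t[q]? = some v) :
    ∃ w : G.Walk u v, w.length = q - p ∧ ∀ x ∈ w.support, x ∈ t := by
  induction q, hpq using Nat.le_induction generalizing v with
  | base =>
    obtain rfl : u = v := by simpa [hu] using hv
    exact ⟨.nil, by simp, by simpa using List.mem_of_getElem? hu⟩
  | succ q hpq ih =>
    obtain ⟨hq, rfl⟩ := List.getElem?_eq_some_iff.1 hv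
    obtain ⟨w, hw, hsupp⟩ := ih (v := t[q]) (by simp)
    refine ⟨w.concat (List.isChain_iff_getElem.1 h q hq), by simp [hw]; omega, ?_⟩
    intro x hx
    rw [Walk.support_concat] at hx
    simp at hx
    rcases hx with hx | rfl
    · exact hsupp x hx
    · simp

/-- Two nodes of the same cluster are joined by a stretch of the traversal shorter than
`diam G`. -/
lemma exists_walk_of_cluster_eq {r : V} {t : List V} {cl : V → ℕ}
    (ht : IsDFSTraversal G D r t) (hcl : IsClustering G D t cl) (hd : 0 < G.diam)
    {u v : V} (hu : u ∈ D) (hv : v ∈ D) (huv : cl u = cl v) :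
    ∃ w : G.Walk u v, w.length < G.diam ∧ ∀ x ∈ w.support, x ∈ D := by
  obtain ⟨p, hp, hpc⟩ := hcl u hu
  obtain ⟨q, hq, hqc⟩ := hcl v hv
  have hdiv : p / G.diam = q / G.diam := by rw [← hpc, ← hqc, huv]
  have h1 := Nat.div_add_mod p G.diam
  have h2 := Nat.div_add_mod q G.diam
  have h3 := Nat.mod_lt p hd
  have h4 := Nat.mod_lt q hd
  rw [hdiv] at h1
  rcases le_total p q with hpq | hpq
  · obtain ⟨w, hw, hs⟩ := exists_walk_of_isChain ht.1.isChain hpq hp hq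
    exact ⟨w, by omega, fun x hx => ht.1.subset x (hs x hx)⟩
  · obtain ⟨w, hw, hs⟩ := exists_walk_of_isChain ht.1.isChain hpq hq hp
    exact ⟨w.reverse, by simp; omega, fun x hx => ht.1.subset x (hs x (by simpa using hx))⟩

/-! ### Cluster leaders -/

section Leaders

variable [LinearOrder V] {cl : V → ℕ}

lemma leaders_subset : leaders D cl ⊆ D := Finset.filter_subset _ _

lemma exists_leader {v : V} (hv : v ∈ D) : ∃ c ∈ leaders D cl, cl c = cl v := by
  have hne : (D.filter fun u => cl u = cl v).Nonempty := ⟨v, by simp [hv]⟩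
  have hmem := Finset.mem_filter.1 (Finset.min'_mem _ hne)
  refine ⟨_, Finset.mem_filter.2 ⟨hmem.1, fun u hu huc => ?_⟩, hmem.2⟩
  exact Finset.min'_le _ _ (Finset.mem_filter.2 ⟨hu, huc.trans hmem.2⟩)

lemma injOn_leaders : Set.InjOn cl (leaders D cl : Set V) := by
  intro a ha b hb hab
  simp only [leaders, Finset.coe_filter, Set.mem_ofPred_eq] at ha hb
  exact le_antisymm (ha.2 b hb.1 hab.symm) (hb.2 a ha.1 hab)

/-- The traversal has at most `2 * |D| - 1` positions, so there are at most
`(2 * |D| - 2) / diam G + 1` clusters. -/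
lemma card_leaders_le {r : V} {t : List V} (ht : IsDFSTraversal G D r t)
    (hcl : IsClustering G D t cl) :
    (leaders D cl).card ≤ (2 * D.card - 2) / G.diam + 1 := by
  rw [← Finset.card_image_of_injOn injOn_leaders, ← Finset.card_range (_ / _ + 1)]
  refine Finset.card_le_card fun k hk => ?_
  obtain ⟨c, hc, rfl⟩ := Finset.mem_image.1 hk
  obtain ⟨p, hp, hpc⟩ := hcl c (leaders_subset hc)
  obtain ⟨hlt, -⟩ := List.getElem?_eq_some_iff.1 hp
  have := ht.length_le
  rw [Finset.mem_range, hpc]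
  exact Nat.lt_succ_of_le (Nat.div_le_div_right (by omega))

end Leaders

/-! ### The output of the algorithm -/

lemma dist_le_diam_of_connected [Finite V] (hG : G.Connected) (u v : V) : G.dist u v ≤ G.diam :=
  have := hG.nonempty
  dist_le_diam (connected_iff_ediam_ne_top.1 hG)

section Output

variable [LinearOrder V] {D₀ : Finset V}

lemma exists_isOutput (hG : G.Connected) (hD₀ : IsCDS G D₀) : ∃ D, IsOutput G D₀ D := by
  obtain ⟨⟨x, hx⟩⟩ := hD₀.2.nonempty
  have hne : D₀.Nonempty := ⟨x, hx⟩
  have hr := D₀.min'_mem hne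
  obtain ⟨t, ht⟩ := (DFSState.start (G := G) _ hr).exists_isDFSTraversal rfl
  have hpos : ∀ v, ∃ p : ℕ, v ∈ D₀ → t[p]? = some v := by
    intro v
    by_cases hv : v ∈ D₀
    · obtain ⟨p, hp⟩ := List.mem_iff_getElem?.1 (ht.mem_of_connected hD₀.2 v hv)
      exact ⟨p, fun _ => hp⟩
    · exact ⟨0, fun h => absurd h hv⟩
  choose pos hpos using hpos
  choose P hP using fun c => (hG c (D₀.min' hne)).exists_walk_length_eq_dist
  exact ⟨_, _, t, fun v => pos v / G.diam, P, ⟨hr, fun v hv => D₀.min'_le v hv⟩, ht,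
    fun v hv => ⟨pos v, hpos v hv, rfl⟩, fun c _ => hP c, rfl⟩

lemma subset_of_isOutput (h : IsOutput G D₀ D) : D₀ ⊆ D := by
  obtain ⟨r, t, cl, P, -, -, -, -, rfl⟩ := h
  exact Finset.subset_union_left

variable [Finite V]

lemma card_le_of_isOutput (hG : G.Connected) (h : IsOutput G D₀ D) : D.card ≤ 3 * D₀.card := by
  obtain ⟨r, t, cl, P, ⟨hr, hmin⟩, ht, hcl, hP, rfl⟩ := h
  have hrl : r ∈ leaders D₀ cl := Finset.mem_filter.2 ⟨hr, fun v hv _ => hmin v hv⟩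
  have hsub : D₀ ∪ (leaders D₀ cl).biUnion (fun c => (P c).support.toFinset) ⊆
      D₀ ∪ ((leaders D₀ cl).erase r).biUnion fun c => (P c).support.toFinset.erase r := by
    intro x hx
    by_cases hxD : x ∈ D₀
    · exact Finset.mem_union_left _ hxD
    obtain ⟨c, hc, hxc⟩ := Finset.mem_biUnion.1 ((Finset.mem_union.1 hx).resolve_left hxD)
    have hxr : x ≠ r := fun h => hxD (h ▸ hr)
    refine Finset.mem_union_right _ (Finset.mem_biUnion.2 ⟨c, ?_, Finset.mem_erase.2 ⟨hxr, hxc⟩⟩)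
    refine Finset.mem_erase.2 ⟨?_, hc⟩
    rintro rfl
    -- The chosen path from the root to itself has length `0`.
    have h0 := Walk.eq_nil_iff_nil.2 (Walk.length_eq_zero_iff.1 ((hP c hc).trans dist_self))
    simp [h0] at hxc
    exact hxr hxc
  have hpath : ∀ c ∈ (leaders D₀ cl).erase r, ((P c).support.toFinset.erase r).card ≤ G.diam := by
    intro c hc
    rw [Finset.card_erase_of_mem (by simp)]
    have h1 := (P c).support.toFinset_card_le
    have h2 := hP c (Finset.mem_of_mem_erase hc)
    have h3 := dist_le_diam_of_connected hG c r
    rw [Walk.length_support] at h1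
    omega
  -- One leader is `r`, so the remaining paths are at most as many as the full blocks of length
  -- `diam G` among the `2 * |D₀| - 2` steps of the traversal; also true if `diam G = 0`.
  have hadd := Finset.card_biUnion_le_card_mul _ _ _ hpath
  rw [Finset.card_erase_of_mem hrl] at hadd
  have hblocks : ((leaders D₀ cl).card - 1) * G.diam ≤ 2 * D₀.card - 2 :=
    (Nat.mul_le_mul_right _ (Nat.sub_le_of_le_add (card_leaders_le ht hcl))).trans
      (Nat.div_mul_le_self _ _)
  have := (Finset.card_le_card hsub).trans (Finset.card_union_le _ _)
  omega

/-- All nodes of an output are within distance `2 * diam G` of the root of the traversal, in the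
subgraph induced by the output. -/
lemma exists_eccent_le_of_isOutput (hG : G.Connected) (h : IsOutput G D₀ D) :
    ∃ r, (G.induce (D : Set V)).eccent r ≤ (2 * G.diam : ℕ) := by
  have hD := subset_of_isOutput h
  obtain ⟨r, t, cl, P, ⟨hr, hmin⟩, ht, hcl, hP, hDeq⟩ := h
  refine ⟨⟨r, hD hr⟩, (eccent_le_iff _ _).2 ?_⟩
  rintro ⟨v, hv⟩
  have hPD : ∀ c ∈ leaders D₀ cl, ∀ x ∈ (P c).support, x ∈ D := by
    intro c hc x hx
    rw [hDeq]
    exact Finset.mem_union_right _ (Finset.mem_biUnion.2 ⟨c, hc, by simpa using hx⟩)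
  have hPlen : ∀ c ∈ leaders D₀ cl, (P c).length ≤ G.diam := fun c hc =>
    (hP c hc).trans_le (dist_le_diam_of_connected hG c r)
  have hwalk : ∃ w : G.Walk v r, w.length ≤ 2 * G.diam ∧ ∀ x ∈ w.support, x ∈ (D : Set V) := by
    by_cases hv0 : v ∈ D₀
    -- If `diam G = 0`, the clusters are computed with the junk value `p / 0 = 0`, but then `v = r`.
    · rcases Nat.eq_zero_or_pos G.diam with hd | hd
      · have h0 := dist_le_diam_of_connected hG v r
        obtain rfl : v = r := hG.dist_eq_zero_iff.1 (by omega)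
        exact ⟨.nil, by simp, by simpa using hv⟩
      · obtain ⟨c, hc, hcv⟩ := exists_leader (cl := cl) hv0
        obtain ⟨w, hw, hws⟩ :=
          exists_walk_of_cluster_eq ht hcl hd hv0 (leaders_subset hc) hcv.symm
        refine ⟨w.append (P c), ?_, fun x hx => ?_⟩
        · have := hPlen c hc
          rw [Walk.length_append]
          omega
        · rcases (Walk.mem_support_append_iff _ _).1 hx with hx | hx
          · exact hD (hws x hx)
          · exact hPD c hc x hx
    · have hv' : v ∈ D := hv
      rw [hDeq] at hv'
      obtain ⟨c, hc, hvc⟩ := Finset.mem_biUnion.1 ((Finset.mem_union.1 hv').resolve_left hv0)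
      have hvc : v ∈ (P c).support := List.mem_toFinset.1 hvc
      refine ⟨(P c).dropUntil v hvc, ?_, fun x hx => ?_⟩
      · have h1 := (P c).length_dropUntil_le_length hvc
        have h2 := hPlen c hc
        omega
      · exact hPD c hc x ((P c).support_dropUntil_subset_support hvc hx)
  obtain ⟨w, hw, hws⟩ := hwalk
  rw [edist_comm]
  refine (edist_le (w.induce _ hws)).trans ?_
  have : (w.induce _ hws).length = w.length := by
    rw [← Walk.length_map (Embedding.induce _).toHom, Walk.map_induce]
    rfl
  rw [this]
  exact_mod_cast hw

lemma ediam_induce_le_of_isOutput (hG : G.Connected) (h : IsOutput G D₀ D) :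
    (G.induce (D : Set V)).ediam ≤ (4 * G.diam : ℕ) := by
  obtain ⟨r, hr⟩ := exists_eccent_le_of_isOutput hG h
  calc (G.induce (D : Set V)).ediam ≤ 2 * (G.induce (D : Set V)).eccent r :=
        ediam_le_two_mul_eccent r
    _ ≤ 2 * (2 * G.diam : ℕ) := by gcongr
    _ = (4 * G.diam : ℕ) := by push_cast; ring

lemma diam_induce_le_of_isOutput (hG : G.Connected) (h : IsOutput G D₀ D) :
    (G.induce (D : Set V)).diam ≤ 4 * G.diam :=
  ENat.toNat_le_of_le_natCast (ediam_induce_le_of_isOutput hG h)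

/-- Domination is inherited from `D₀`, and connectedness follows from the finite diameter. -/
lemma isCDS_of_isOutput (hG : G.Connected) (hD₀ : IsCDS G D₀) (h : IsOutput G D₀ D) :
    IsCDS G D := by
  have hD := subset_of_isOutput h
  refine ⟨fun v => (hD₀.1 v).imp (@hD v) fun ⟨u, hu, huv⟩ => ⟨u, hD hu, huv⟩, ?_⟩
  have : Nonempty (D : Set V) := hD₀.2.nonempty.map fun x => ⟨x.1, hD x.2⟩
  exact connected_of_ediam_ne_top
    (ne_top_of_le_ne_top (ENat.natCast_ne_top _) (ediam_induce_le_of_isOutput hG h))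

end Output

end ShortCDS

theorem mainTheorem2 {V : Type*} [Fintype V] [LinearOrder V] (G : SimpleGraph V)
    [DecidableRel G.Adj] (hG : G.Connected)
    (Dopt : Finset V) (hopt : ShortCDS.IsMinCDS G Dopt)
    (D₀ : Finset V) (hD₀ : ShortCDS.IsCDS G D₀) :
    (∃ D : Finset V, ShortCDS.IsOutput G D₀ D) ∧
    ∀ D : Finset V, ShortCDS.IsOutput G D₀ D →
      ShortCDS.IsCDS G D ∧
      (G.induce (D : Set V)).diam ≤ 4 * G.diam ∧
      (∀ α : ℝ, (D₀.card : ℝ) ≤ α * (Dopt.card : ℝ) →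
        (D.card : ℝ) ≤ 3 * α * (Dopt.card : ℝ)) ∧
      ((D₀.card : ℝ) ≤ (2 + (harmonic G.maxDegree : ℝ)) * (Dopt.card : ℝ) →
        (D.card : ℝ) ≤ 3 * (2 + (harmonic G.maxDegree : ℝ)) * (Dopt.card : ℝ)) ∧
      (ShortCDS.IsUnitDiskGraph G →
        ((D₀.card : ℝ) ≤ (7.8 : ℝ) * (Dopt.card : ℝ) →
          (D.card : ℝ) ≤ (23.4 : ℝ) * (Dopt.card : ℝ)) ∧
        ((D₀.card : ℝ) ≤ (5.2 : ℝ) * (Dopt.card : ℝ) →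
          (D.card : ℝ) ≤ (15.6 : ℝ) * (Dopt.card : ℝ))) := by
  refine ⟨ShortCDS.exists_isOutput hG hD₀, fun D hD => ?_⟩
  have hcard : (D.card : ℝ) ≤ 3 * (D₀.card : ℝ) := by
    exact_mod_cast ShortCDS.card_le_of_isOutput hG hD
  refine ⟨ShortCDS.isCDS_of_isOutput hG hD₀ hD, ShortCDS.diam_induce_le_of_isOutput hG hD,
    fun α h => ?_, fun h => ?_, fun _ => ⟨fun h => ?_, fun h => ?_⟩⟩ <;> linarith
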